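/- Let $M_1$ and $M_2$ be smooth manifolds without boundary, with $M_2$ non-empty and $m_2=\dim M_2\ge 1$, and let $0<T\le\infty$. For $t\in[0,T)$ let $g_1(t)$ be a smooth Riemannian metric on $M_1$ and let $\lambda(\cdot,t)$ be a strictly positive smooth function on $M_1$. Let $g_2$ be a fixed (time-independent) Einstein metric on $M_2$ with constant $c\in\mathbb R$, that is, ${}^{M_2}\mathrm{Ric}=c\,g_2$. Suppose that the family of warped product metrics $$\bar g(x,y,t)=g_1(x,t)\oplus\lambda^2(x,t)\,g_2(y),\qquad t\in[0,T),$$ is a solution to the hyperbolic geometric flow on $M_1\times M_2$, that is, $\bar g$ is twice differentiable in $t$ and $$\frac{\partial^2}{\partial t^2}\bar g(t)=-2\,\overline{\mathrm{Ric}},$$ where $\overline{\mathrm{Ric}}$ is the Ricci tensor of $\bar g(t)$. Then $g_1$ and $\lambda^2$ are twice differentiable in $t$ and satisfy, on $M_1\times[0,T)$, the evolution equations $$\frac{\partial^2}{\partial t^2}g_1=-2\,{}^{M_1}\mathrm{Ric}+\frac{2m_2}{\lambda}\,\mathrm{Hess}(\lambda),$$ $$\frac{\partial^2}{\partial t^2}\lambda^2=-2c+\Delta_{M_1}\lambda^2+(2m_2-4)\,|\mathrm{grad}\,\lambda|^2,$$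 where ${}^{M_1}\mathrm{Ric}$, the Hessian $\mathrm{Hess}=\nabla d$, the Laplacian $\Delta_{M_1}=\mathrm{tr}_{g_1}\mathrm{Hess}$, the gradient and the norm are those of the metric $g_1(t)$ on $M_1$. (Derivatives in $t$ at $t=0$ are one-sided.) -/

import Mathlib

set_option maxSynthPendingDepth 3

open Set
open scoped Manifold ContDiff Bundle

noncomputable section

namespace WarpedFlow

/-! ### Riemannian geometry of a metric on (an open part of) a finite-dimensional vector space

`G z` is the metric at the point `z`, in the coordinates of the vector space `E`. -/

section Euclidean

variable {E : Type*} [NormedAddCommGroup E] [NormedSpace ℝ E]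

/-- The lowered Christoffel symbols:
`(v, w, u) ↦ (∂ᵥ G(w, u) + ∂_w G(v, u) - ∂ᵤ G(v, w)) / 2` at `z`, see `christoffelLower_apply`. -/
def christoffelLower (G : E → E →L[ℝ] E →L[ℝ] ℝ) (z : E) : E →L[ℝ] E →L[ℝ] E →L[ℝ] ℝ :=
  (1 / 2 : ℝ) • (fderiv ℝ G z + (fderiv ℝ G z).flip -
    ((ContinuousLinearMap.flipₗᵢ ℝ E E ℝ).toContinuousLinearEquiv :
      (E →L[ℝ] E →L[ℝ] ℝ) →L[ℝ] (E →L[ℝ] E →L[ℝ] ℝ)) ∘L (fderiv ℝ G z).flip)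

theorem christoffelLower_apply (G : E → E →L[ℝ] E →L[ℝ] ℝ) (z v w u : E) :
    christoffelLower G z v w u =
      (1 / 2) * (fderiv ℝ G z v w u + fderiv ℝ G z w v u - fderiv ℝ G z u v w) := by
  simp [christoffelLower]

/-- The Christoffel symbols `Γ(v, w)` of the Levi-Civita connection of `G` at `z`: the index is
raised by the inverse of the isomorphism `G z : E → E*`. -/
def christoffel (G : E → E →L[ℝ] E →L[ℝ] ℝ) (z : E) : E →L[ℝ] E →L[ℝ] E :=
  (ContinuousLinearMap.compL ℝ E (E →L[ℝ] ℝ) E (G z).inverse) ∘L christoffelLower G z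

theorem christoffel_apply (G : E → E →L[ℝ] E →L[ℝ] ℝ) (z v w : E) :
    christoffel G z v w = (G z).inverse (christoffelLower G z v w) := rfl

/-- The endomorphism `u ↦ R(u, v) w` at `z`, where `R(X, Y) = [∇_X, ∇_Y] - ∇_[X, Y]` is the
curvature of the Levi-Civita connection of `G`. -/
def curvatureEndo (G : E → E →L[ℝ] E →L[ℝ] ℝ) (z v w : E) : E →ₗ[ℝ] E where
  toFun u := fderiv ℝ (christoffel G) z u v w - fderiv ℝ (christoffel G) z v u w
    + christoffel G z u (christoffel G z v w) - christoffel G z v (christoffel G z u w)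
  map_add' a b := by simp only [map_add, add_apply]; abel
  map_smul' r a := by
    simp only [map_smul, smul_apply, RingHom.id_apply, smul_sub, smul_add]

/-- The Ricci curvature `Ric(v, w) = tr (u ↦ R(u, v) w)` of `G` at `z`. -/
def ricciCoord (G : E → E →L[ℝ] E →L[ℝ] ℝ) (z v w : E) : ℝ :=
  LinearMap.trace ℝ E (curvatureEndo G z v w)

/-- The Hessian `∇df` at `z`: `(v, w) ↦ ∂ᵥ∂_w f - df(Γ(v, w))`. -/
def hessianCoord (G : E → E →L[ℝ] E →L[ℝ] ℝ) (f : E → ℝ) (z : E) : E →L[ℝ] E →L[ℝ] ℝ :=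
  fderiv ℝ (fderiv ℝ f) z -
    (ContinuousLinearMap.compL ℝ E E ℝ (fderiv ℝ f z)) ∘L christoffel G z

theorem hessianCoord_apply (G : E → E →L[ℝ] E →L[ℝ] ℝ) (f : E → ℝ) (z v w : E) :
    hessianCoord G f z v w =
      fderiv ℝ (fderiv ℝ f) z v w - fderiv ℝ f z (christoffel G z v w) := rfl

end Euclidean

/-! ### Riemannian metrics on manifolds -/

section Manifold

variable {E : Type*} [NormedAddCommGroup E] [NormedSpace ℝ E]
  {H : Type*} [TopologicalSpace H] (I : ModelWithCorners ℝ E H)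
  (M : Type*) [TopologicalSpace M] [ChartedSpace H M]

/-- A field of bilinear forms on the tangent spaces of `M`. -/
abbrev FormField : Type _ :=
  ∀ x : M, TangentSpace I x →L[ℝ] TangentSpace I x →L[ℝ] ℝ

variable {M}

/-- `g` is a smooth Riemannian metric on `M`. (On a finite-dimensional manifold these are exactly
the fields underlying a `Bundle.ContMDiffRiemannianMetric` of class `C^∞`.) -/
structure IsRiemannianMetric [IsManifold I ∞ M] (g : FormField I M) : Prop where
  symm : ∀ (x : M) (v w : TangentSpace I x), g x v w = g x w v
  pos : ∀ (x : M) (v : TangentSpace I x), v ≠ 0 → 0 < g x v v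
  smooth :
    ContMDiff I (I.prod 𝓘(ℝ, E →L[ℝ] E →L[ℝ] ℝ)) ∞
      (fun x ↦ Bundle.TotalSpace.mk' (E →L[ℝ] E →L[ℝ] ℝ)
        (E := fun x ↦ TangentSpace I x →L[ℝ] TangentSpace I x →L[ℝ] ℝ) x (g x))

/-- The pullback `(v, w) ↦ B(A v, A w)` of a bilinear form. -/
def pullbackForm {V W : Type*} [AddCommGroup V] [Module ℝ V] [TopologicalSpace V]
    [IsTopologicalAddGroup V] [ContinuousSMul ℝ V]
    [AddCommGroup W] [Module ℝ W] [TopologicalSpace W]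
    [IsTopologicalAddGroup W] [ContinuousSMul ℝ W]
    (B : W →L[ℝ] W →L[ℝ] ℝ) (A : V →L[ℝ] W) : V →L[ℝ] V →L[ℝ] ℝ :=
  (ContinuousLinearMap.precomp ℝ A) ∘L B ∘L A

theorem pullbackForm_apply {V W : Type*} [AddCommGroup V] [Module ℝ V] [TopologicalSpace V]
    [IsTopologicalAddGroup V] [ContinuousSMul ℝ V]
    [AddCommGroup W] [Module ℝ W] [TopologicalSpace W]
    [IsTopologicalAddGroup W] [ContinuousSMul ℝ W]
    (B : W →L[ℝ] W →L[ℝ] ℝ) (A : V →L[ℝ] W) (v w : V) :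
    pullbackForm B A v w = B (A v) (A w) := rfl

/-- The metric `g` in the preferred chart around `p`, i.e. its pullback by the inverse chart.
Only its values on the target of the chart are meaningful. -/
def inChart (g : FormField I M) (p : M) (z : E) : E →L[ℝ] E →L[ℝ] ℝ :=
  pullbackForm (V := E) (W := E) (g ((extChartAt I p).symm z))
    (mfderiv 𝓘(ℝ, E) I (extChartAt I p).symm z)

/-- The Ricci tensor of `g`, computed at each point `x` in the preferred chart around `x`. By
Mathlib's definition of `TangentSpace I x`, a tangent vector at `x` is its own coordinate vector
in that chart. -/
def ricci (g : FormField I M) (x : M) (v w : TangentSpace I x) : ℝ :=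
  ricciCoord (inChart I g x) (extChartAt I x x) v w

/-- The Hessian of `f` with respect to `g`, computed at `x` in the preferred chart around `x`. -/
def hessian (g : FormField I M) (f : M → ℝ) (x : M) :
    TangentSpace I x →L[ℝ] TangentSpace I x →L[ℝ] ℝ :=
  (hessianCoord (inChart I g x) (f ∘ (extChartAt I x).symm) (extChartAt I x x) :
    E →L[ℝ] E →L[ℝ] ℝ)

/-- The Laplacian `Δ f`, the trace of the Hessian with respect to `g`. -/
def laplacian (g : FormField I M) (f : M → ℝ) (x : M) : ℝ :=
  LinearMap.trace ℝ (TangentSpace I x) ((g x).inverse ∘L hessian I g f x :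
    TangentSpace I x →L[ℝ] TangentSpace I x)

/-- The gradient of `f`: `df` with its index raised by the inverse of `g x : T_x M → T_x* M`. -/
def grad (g : FormField I M) (f : M → ℝ) (x : M) : TangentSpace I x :=
  (g x).inverse (mfderiv I 𝓘(ℝ, ℝ) f x)

/-- `|grad f|²`. -/
def gradNormSq (g : FormField I M) (f : M → ℝ) (x : M) : ℝ :=
  g x (grad I g f x) (grad I g f x)

/-- `g` is an Einstein metric with constant `c`: `Ric = c g`. -/
def IsEinstein [IsManifold I ∞ M] (g : FormField I M) (c : ℝ) : Prop :=
  IsRiemannianMetric I g ∧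
    ∀ (x : M) (v w : TangentSpace I x), ricci I g x v w = c * g x v w

end Manifold

/-! ### The hyperbolic geometric flow -/

/-- The time interval `[0, T)`, where `T = ∞` is allowed. -/
def timeInterval (T : EReal) : Set ℝ := {t : ℝ | 0 ≤ t ∧ (t : EReal) < T}

/-- `f` is twice differentiable on `s` (from within `s`) with second derivative `f''`. -/
def HasSecondDerivOn (f f'' : ℝ → ℝ) (s : Set ℝ) : Prop :=
  ∃ f' : ℝ → ℝ, (∀ t ∈ s, HasDerivWithinAt f (f' t) s t) ∧
    ∀ t ∈ s, HasDerivWithinAt f' (f'' t) s t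

/-- A family `g t` of Riemannian metrics, `t ∈ [0, T)`, solves the hyperbolic geometric flow
`∂²g/∂t² = -2 Ric(g)`. -/
structure IsHyperbolicGeometricFlow {E : Type*} [NormedAddCommGroup E] [NormedSpace ℝ E]
    {H : Type*} [TopologicalSpace H] (I : ModelWithCorners ℝ E H)
    {M : Type*} [TopologicalSpace M] [ChartedSpace H M] [IsManifold I ∞ M]
    (T : EReal) (g : ℝ → FormField I M) : Prop where
  isRiemannianMetric : ∀ t ∈ timeInterval T, IsRiemannianMetric I (g t)
  evolution : ∀ (x : M) (v w : TangentSpace I x),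
    HasSecondDerivOn (fun t ↦ g t x v w) (fun t ↦ -2 * ricci I (g t) x v w) (timeInterval T)

/-! ### Warped products -/

/-- The warped product metric `g₁ ⊕ λ² g₂` on `M₁ × M₂`:
`(X, Y) ↦ g₁(dπ₁ X, dπ₁ Y) + λ² g₂(dπ₂ X, dπ₂ Y)`. -/
def warpedProduct
    {E₁ : Type*} [NormedAddCommGroup E₁] [NormedSpace ℝ E₁]
    {H₁ : Type*} [TopologicalSpace H₁] (I₁ : ModelWithCorners ℝ E₁ H₁)
    {M₁ : Type*} [TopologicalSpace M₁] [ChartedSpace H₁ M₁]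
    {E₂ : Type*} [NormedAddCommGroup E₂] [NormedSpace ℝ E₂]
    {H₂ : Type*} [TopologicalSpace H₂] (I₂ : ModelWithCorners ℝ E₂ H₂)
    {M₂ : Type*} [TopologicalSpace M₂] [ChartedSpace H₂ M₂]
    (g₁ : FormField I₁ M₁) (lam : M₁ → ℝ) (g₂ : FormField I₂ M₂) :
    FormField (I₁.prod I₂) (M₁ × M₂) := fun p ↦
  pullbackForm (g₁ p.1) (mfderiv (I₁.prod I₂) I₁ Prod.fst p) +
    (lam p.1) ^ 2 • pullbackForm (g₂ p.2) (mfderiv (I₁.prod I₂) I₂ Prod.snd p)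

end WarpedFlow

end

/-! The statement follows from O'Neill's formulas for the Ricci tensor of a warped product
`g₁ ⊕ λ² g₂` whose fibre has dimension `m₂`: on vectors tangent to the base,
`Ric(X, Y) = Ric₁(X, Y) - (m₂ / λ) Hess λ (X, Y)`, and on vectors tangent to the fibre,
`Ric(V, W) = Ric₂(V, W) - (λ Δλ + (m₂ - 1) |grad λ|²) g₂(V, W)`. These are
`ricci_warpedProduct_horizontal` and `ricci_warpedProduct_vertical`. The flow equation on the pairs
`(v, 0)`, `(w, 0)` is then the equation for `g₁`. On `(0, b)` with `b ≠ 0`, divided by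
`g₂(b, b) > 0`, it is the equation for `λ²`, because `Ric₂ = c g₂` and
`Δ λ² = 2 λ Δλ + 2 |grad λ|²`.

Both formulas are computed in coordinates. In a product chart the warped product is
`G₁(x) + f(x)² G₂(y)` on an open subset of `E₁ × E₂` (`inChart_warpedProduct`), and the Ricci tensor
at a point depends only on the germ of the metric there (`ricciCoord_congr`). The Christoffel
symbols of this metric are given by `christoffel_warpedCoord`; it suffices to check the formula
after lowering an index, since the metric is nondegenerate. Differentiating it gives the curvature
endomorphism `u ↦ R(u, v) w`, whose trace is the sum of the traces of its two diagonal blocks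
(`trace_prod_eq_add`). The Hessian enters the base block through `∇ᵤ grad f = (Hess f (u, ·))♯`
(`fderiv_gradCoord_add_christoffel`). -/

namespace WarpedFlow

/-! ### Riemannian metrics on open subsets of a vector space -/

section Coordinates

open Filter Topology

variable {E : Type*} [NormedAddCommGroup E] [NormedSpace ℝ E]

/-- `G` is a Riemannian metric of class `C^2` on the open set `U`; two derivatives are all that
the curvature at a point of `U` needs. -/
structure IsMetricOn (G : E → E →L[ℝ] E →L[ℝ] ℝ) (U : Set E) : Prop where
  isOpen : IsOpen U
  contDiffOn : ContDiffOn ℝ 2 G U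
  symm : ∀ z ∈ U, ∀ v w, G z v w = G z w v
  pos : ∀ z ∈ U, ∀ v, v ≠ 0 → 0 < G z v v

theorem hasFDerivAt_apply_apply {F : Type*} [NormedAddCommGroup F] [NormedSpace ℝ F]
    {B : E → E →L[ℝ] E →L[ℝ] F} {z : E} (hB : DifferentiableAt ℝ B z)
    (v w : E) : HasFDerivAt (fun y ↦ B y v w) (((fderiv ℝ B z).flip v).flip w) z := by
  simpa using (hB.hasFDerivAt.clm_apply (hasFDerivAt_const v z)).clm_apply (hasFDerivAt_const w z)

/-- The gradient of `f` with respect to the metric `G`. -/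
noncomputable def gradCoord (G : E → E →L[ℝ] E →L[ℝ] ℝ) (f : E → ℝ) (z : E) : E :=
  (G z).inverse (fderiv ℝ f z)

theorem isInvertible_of_pos [FiniteDimensional ℝ E] {B : E →L[ℝ] E →L[ℝ] ℝ}
    (hB : ∀ v, v ≠ 0 → 0 < B v v) : B.IsInvertible := by
  have hinj : Function.Injective (B : E →ₗ[ℝ] E →L[ℝ] ℝ) := by
    rw [← LinearMap.ker_eq_bot, LinearMap.ker_eq_bot']
    intro v hv
    by_contra h
    have h1 := hB v h
    have h2 : B v = 0 := hv
    simp [h2] at h1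
  have hdim : Module.finrank ℝ E = Module.finrank ℝ (E →L[ℝ] ℝ) := by
    rw [← (LinearMap.toContinuousLinearMap (𝕜 := ℝ) (E := E) (F' := ℝ)).finrank_eq]
    exact (Subspace.dual_finrank_eq (K := ℝ) (V := E)).symm
  refine ⟨(LinearEquiv.ofInjectiveOfFinrankEq (B : E →ₗ[ℝ] E →L[ℝ] ℝ) hinj
    hdim).toContinuousLinearEquiv, ?_⟩
  ext v w
  rfl

namespace IsMetricOn

variable {G : E → E →L[ℝ] E →L[ℝ] ℝ} {U : Set E} {z : E}

theorem isInvertible [FiniteDimensional ℝ E] (h : IsMetricOn G U) (hz : z ∈ U) :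
    (G z).IsInvertible :=
  isInvertible_of_pos (h.pos z hz)

theorem contDiffAt (h : IsMetricOn G U) (hz : z ∈ U) : ContDiffAt ℝ 2 G z :=
  (h.contDiffOn z hz).contDiffAt (h.isOpen.mem_nhds hz)

theorem differentiableAt (h : IsMetricOn G U) (hz : z ∈ U) : DifferentiableAt ℝ G z :=
  (h.contDiffAt hz).differentiableAt (by norm_num)

theorem fderiv_symm (h : IsMetricOn G U) (hz : z ∈ U) (u v w : E) :
    fderiv ℝ G z u v w = fderiv ℝ G z u w v := by
  have key (a b : E) : fderiv ℝ G z u a b = fderiv ℝ (fun y ↦ G y a b) z u := by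
    rw [(hasFDerivAt_apply_apply (h.differentiableAt hz) a b).fderiv]; rfl
  rw [key, key]
  have : (fun y ↦ G y v w) =ᶠ[𝓝 z] fun y ↦ G y w v := by
    filter_upwards [h.isOpen.mem_nhds hz] with y hy using h.symm y hy v w
  rw [this.fderiv_eq]

/-- The defining property of the Christoffel symbols: lowering the index. -/
theorem apply_christoffel [FiniteDimensional ℝ E] (h : IsMetricOn G U) (hz : z ∈ U) (v w u : E) :
    G z (christoffel G z v w) u = christoffelLower G z v w u := by
  rw [christoffel_apply, (h.isInvertible hz).self_apply_inverse]

theorem apply_gradCoord [FiniteDimensional ℝ E] (h : IsMetricOn G U) (hz : z ∈ U)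
    (f : E → ℝ) (u : E) : G z (gradCoord G f z) u = fderiv ℝ f z u := by
  rw [gradCoord, (h.isInvertible hz).self_apply_inverse]

theorem contDiffAt_inverse [FiniteDimensional ℝ E] (h : IsMetricOn G U) (hz : z ∈ U) :
    ContDiffAt ℝ 2 (fun y ↦ (G y).inverse) z :=
  haveI : CompleteSpace E := FiniteDimensional.complete ℝ E
  ((h.isInvertible hz).contDiffAt_map_inverse).comp z (h.contDiffAt hz)

theorem differentiableAt_christoffel [FiniteDimensional ℝ E] (h : IsMetricOn G U) (hz : z ∈ U) :
    DifferentiableAt ℝ (christoffel G) z := by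
  have h1 : DifferentiableAt ℝ (fun y ↦ (G y).inverse) z :=
    (h.contDiffAt_inverse hz).differentiableAt (by norm_num)
  have h2 : DifferentiableAt ℝ (fderiv ℝ G) z :=
    ((h.contDiffAt hz).fderiv_right (m := 1) (by norm_num)).differentiableAt (by norm_num)
  have h3 : DifferentiableAt ℝ (fun y ↦ (fderiv ℝ G y).flip) z :=
    ((ContinuousLinearMap.flipₗᵢ ℝ E E (E →L[ℝ] ℝ)).toContinuousLinearEquiv.differentiableAt).comp
      z h2
  have h4 : DifferentiableAt ℝ (christoffelLower G) z :=
    ((h2.add h3).sub ((differentiableAt_const _).clm_comp h3)).const_smul (1 / 2 : ℝ)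
  exact ((ContinuousLinearMap.compL ℝ E (E →L[ℝ] ℝ) E).differentiableAt.comp z h1).clm_comp h4

theorem differentiableAt_gradCoord [FiniteDimensional ℝ E] (h : IsMetricOn G U) (hz : z ∈ U)
    {f : E → ℝ} (hf : ContDiffAt ℝ 2 f z) : DifferentiableAt ℝ (gradCoord G f) z :=
  ((h.contDiffAt_inverse hz).differentiableAt (by norm_num)).clm_apply
    ((hf.fderiv_right (m := 1) (by norm_num)).differentiableAt (by norm_num))

/-- The covariant derivative of the gradient is the Hessian with one index raised. -/
theorem fderiv_gradCoord_add_christoffel [FiniteDimensional ℝ E] (h : IsMetricOn G U) (hz : z ∈ U)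
    {f : E → ℝ} (hf : ContDiffAt ℝ 2 f z) (u : E) :
    fderiv ℝ (gradCoord G f) z u + christoffel G z u (gradCoord G f z) =
      (G z).inverse (hessianCoord G f z u) := by
  rw [eq_comm, (h.isInvertible hz).inverse_apply_eq]
  ext w
  have hG := (h.differentiableAt hz).hasFDerivAt
  have hgr := (h.differentiableAt_gradCoord hz hf).hasFDerivAt
  have hdf := ((hf.fderiv_right (m := 1) (by norm_num)).differentiableAt (by norm_num)).hasFDerivAt
  have e1 := (hG.clm_apply hgr)
  have e2 : (fun y ↦ G y (gradCoord G f y)) =ᶠ[𝓝 z] fderiv ℝ f := by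
    filter_upwards [h.isOpen.mem_nhds hz] with y hy
    ext a
    exact h.apply_gradCoord hy f a
  have e3 := e1.unique (hdf.congr_of_eventuallyEq e2)
  -- `e4` is the derivative of `G(grad f, w) = df(w)` in the direction `u`
  have e4 := DFunLike.congr_fun (DFunLike.congr_fun e3 u) w
  simp only [add_apply, ContinuousLinearMap.comp_apply,
    ContinuousLinearMap.flip_apply] at e4
  rw [hessianCoord_apply, ← h.apply_gradCoord hz f (christoffel G z u w),
    h.symm z hz (gradCoord G f z), h.apply_christoffel hz, map_add, add_apply,
    h.apply_christoffel hz,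
    christoffelLower_apply, christoffelLower_apply, ← e4, h.fderiv_symm hz u w,
    h.fderiv_symm hz w u]
  ring

end IsMetricOn

/-! ### Locality of the Ricci tensor -/

theorem christoffel_congr {G G' : E → E →L[ℝ] E →L[ℝ] ℝ} {z : E} (h : G =ᶠ[𝓝 z] G') :
    christoffel G z = christoffel G' z := by
  simp only [christoffel, christoffelLower, h.fderiv_eq, h.eq_of_nhds]

theorem ricciCoord_congr {G G' : E → E →L[ℝ] E →L[ℝ] ℝ} {z : E} (h : G =ᶠ[𝓝 z] G')
    (v w : E) : ricciCoord G z v w = ricciCoord G' z v w := by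
  have h1 : christoffel G =ᶠ[𝓝 z] christoffel G' :=
    h.eventuallyEq_nhds.mono fun y hy ↦ christoffel_congr hy
  unfold ricciCoord
  congr 1
  ext u
  simp only [curvatureEndo, LinearMap.coe_mk, AddHom.coe_mk, h1.fderiv_eq, h1.eq_of_nhds]

/-! ### The square of a function -/

/-- `Δ f² = 2 f Δ f + 2 |grad f|²`, in terms of the Hessian with one index raised. -/
theorem trace_inverse_hessianCoord_sq [FiniteDimensional ℝ E] {G : E → E →L[ℝ] E →L[ℝ] ℝ}
    {z : E} {f : E → ℝ} (hf : ContDiffAt ℝ 2 f z) :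
    LinearMap.trace ℝ E ((G z).inverse ∘L hessianCoord G (fun y ↦ f y ^ 2) z : E →L[ℝ] E) =
      2 * f z * LinearMap.trace ℝ E ((G z).inverse ∘L hessianCoord G f z : E →L[ℝ] E) +
        2 * fderiv ℝ f z (gradCoord G f z) := by
  have hfd : ∀ᶠ y in 𝓝 z, fderiv ℝ (fun y ↦ f y ^ 2) y = (2 * f y) • fderiv ℝ f y := by
    filter_upwards [hf.eventually (by norm_num)] with y hy
    have := (hy.differentiableAt (by norm_num)).hasFDerivAt.pow 2
    rw [this.fderiv]; simp
  have hdf := ((hf.fderiv_right (m := 1) (by norm_num)).differentiableAt (by norm_num)).hasFDerivAt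
  have hf1 := (hf.differentiableAt (by norm_num)).hasFDerivAt
  have h2 := (((hf1.const_mul 2).smul hdf).congr_of_eventuallyEq hfd).fderiv
  have key : (((G z).inverse ∘L hessianCoord G (fun y ↦ f y ^ 2) z : E →L[ℝ] E) : E →ₗ[ℝ] E) =
      (2 * f z) • (((G z).inverse ∘L hessianCoord G f z : E →L[ℝ] E) : E →ₗ[ℝ] E) +
        (2 : ℝ) • (fderiv ℝ f z : E →ₗ[ℝ] ℝ).smulRight (gradCoord G f z) := by
    ext u
    have h3 : hessianCoord G (fun y ↦ f y ^ 2) z u =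
        (2 * f z) • hessianCoord G f z u + (2 * fderiv ℝ f z u) • fderiv ℝ f z := by
      ext w
      simp only [hessianCoord_apply, h2, hfd.self_of_nhds, add_apply,
        smul_apply, ContinuousLinearMap.smulRight_apply, smul_eq_mul]
      ring
    simp only [ContinuousLinearMap.coe_coe, ContinuousLinearMap.comp_apply, h3, map_add, map_smul,
      LinearMap.add_apply, LinearMap.smul_apply, LinearMap.smulRight_apply, gradCoord, smul_smul]
  rw [key, map_add, map_smul, map_smul, LinearMap.trace_smulRight]
  simp

end Coordinates

/-! ### Warped products in coordinates -/

section WarpedCoordinates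

open Filter Topology

variable {E₁ : Type*} [NormedAddCommGroup E₁] [NormedSpace ℝ E₁]
  {E₂ : Type*} [NormedAddCommGroup E₂] [NormedSpace ℝ E₂]

/-- The warped product metric `G₁ ⊕ f² G₂` on (an open part of) `E₁ × E₂`. -/
noncomputable def warpedCoord (G₁ : E₁ → E₁ →L[ℝ] E₁ →L[ℝ] ℝ) (f : E₁ → ℝ)
    (G₂ : E₂ → E₂ →L[ℝ] E₂ →L[ℝ] ℝ) (z : E₁ × E₂) : (E₁ × E₂) →L[ℝ] (E₁ × E₂) →L[ℝ] ℝ :=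
  pullbackForm (G₁ z.1) (ContinuousLinearMap.fst ℝ E₁ E₂) +
    f z.1 ^ 2 • pullbackForm (G₂ z.2) (ContinuousLinearMap.snd ℝ E₁ E₂)

theorem warpedCoord_apply (G₁ : E₁ → E₁ →L[ℝ] E₁ →L[ℝ] ℝ) (f : E₁ → ℝ)
    (G₂ : E₂ → E₂ →L[ℝ] E₂ →L[ℝ] ℝ) (z v w : E₁ × E₂) :
    warpedCoord G₁ f G₂ z v w = G₁ z.1 v.1 w.1 + f z.1 ^ 2 * G₂ z.2 v.2 w.2 := rfl

/-- The trace of an endomorphism of a product is the sum of the traces of its diagonal blocks. -/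
theorem trace_prod_eq_add [FiniteDimensional ℝ E₁] [FiniteDimensional ℝ E₂]
    (A : (E₁ × E₂) →ₗ[ℝ] (E₁ × E₂)) :
    LinearMap.trace ℝ (E₁ × E₂) A =
      LinearMap.trace ℝ E₁ (LinearMap.fst ℝ E₁ E₂ ∘ₗ A ∘ₗ LinearMap.inl ℝ E₁ E₂) +
        LinearMap.trace ℝ E₂ (LinearMap.snd ℝ E₁ E₂ ∘ₗ A ∘ₗ LinearMap.inr ℝ E₁ E₂) := by
  rw [LinearMap.trace_comp_comm', LinearMap.trace_comp_comm' _ (LinearMap.snd ℝ E₁ E₂), ← map_add]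
  congr 1
  ext u <;> simp [Prod.mk_zero_zero]

variable [FiniteDimensional ℝ E₁] [FiniteDimensional ℝ E₂]
  {G₁ : E₁ → E₁ →L[ℝ] E₁ →L[ℝ] ℝ} {f : E₁ → ℝ} {G₂ : E₂ → E₂ →L[ℝ] E₂ →L[ℝ] ℝ}
  {U₁ : Set E₁} {U₂ : Set E₂}

theorem IsMetricOn.warpedCoord (h₁ : IsMetricOn G₁ U₁) (h₂ : IsMetricOn G₂ U₂)
    (hf : ContDiffOn ℝ 2 f U₁) (hf0 : ∀ x ∈ U₁, f x ≠ 0) :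
    IsMetricOn (warpedCoord G₁ f G₂) (U₁ ×ˢ U₂) where
  isOpen := h₁.isOpen.prod h₂.isOpen
  contDiffOn := by
    rw [contDiffOn_clm_apply]
    intro v
    rw [contDiffOn_clm_apply]
    intro w
    simp only [warpedCoord_apply]
    have m₁ : MapsTo (Prod.fst : E₁ × E₂ → E₁) (U₁ ×ˢ U₂) U₁ := fun z hz ↦ hz.1
    have m₂ : MapsTo (Prod.snd : E₁ × E₂ → E₂) (U₁ ×ˢ U₂) U₂ := fun z hz ↦ hz.2
    have k₁ := h₁.contDiffOn.comp contDiffOn_fst m₁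
    have k₂ := h₂.contDiffOn.comp contDiffOn_snd m₂
    have k := hf.comp contDiffOn_fst m₁
    exact ((k₁.clm_apply contDiffOn_const).clm_apply contDiffOn_const).add
      ((k.pow 2).mul ((k₂.clm_apply contDiffOn_const).clm_apply contDiffOn_const))
  symm z hz v w := by
    rw [warpedCoord_apply, warpedCoord_apply, h₁.symm _ hz.1, h₂.symm _ hz.2]
  pos z hz v hv := by
    rw [warpedCoord_apply]
    have hp : 0 < f z.1 ^ 2 := by have := hf0 _ hz.1; positivity
    have n₁ : 0 ≤ G₁ z.1 v.1 v.1 := by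
      rcases eq_or_ne v.1 0 with h | h
      · simp [h]
      · exact (h₁.pos _ hz.1 _ h).le
    have n₂ : 0 ≤ G₂ z.2 v.2 v.2 := by
      rcases eq_or_ne v.2 0 with h | h
      · simp [h]
      · exact (h₂.pos _ hz.2 _ h).le
    rcases eq_or_ne v.1 0 with h | h
    · have h' : v.2 ≠ 0 := fun h' ↦ hv (Prod.ext h h')
      exact add_pos_of_nonneg_of_pos n₁ (mul_pos hp (h₂.pos _ hz.2 _ h'))
    · exact add_pos_of_pos_of_nonneg (h₁.pos _ hz.1 _ h) (mul_nonneg hp.le n₂)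

theorem fderiv_warpedCoord (h₁ : IsMetricOn G₁ U₁) (h₂ : IsMetricOn G₂ U₂)
    (hf : ContDiffOn ℝ 2 f U₁) (hf0 : ∀ x ∈ U₁, f x ≠ 0) {z : E₁ × E₂} (hz : z ∈ U₁ ×ˢ U₂)
    (u v w : E₁ × E₂) :
    fderiv ℝ (warpedCoord G₁ f G₂) z u v w = fderiv ℝ G₁ z.1 u.1 v.1 w.1 +
      (f z.1 ^ 2 * fderiv ℝ G₂ z.2 u.2 v.2 w.2 +
        2 * f z.1 * fderiv ℝ f z.1 u.1 * G₂ z.2 v.2 w.2) := by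
  have e1 := hasFDerivAt_apply_apply ((h₁.warpedCoord h₂ hf hf0).differentiableAt hz) v w
  have k₁ := (hasFDerivAt_apply_apply (h₁.differentiableAt hz.1) v.1 w.1).comp z hasFDerivAt_fst
  have k₂ := (hasFDerivAt_apply_apply (h₂.differentiableAt hz.2) v.2 w.2).comp z hasFDerivAt_snd
  have k := ((((hf z.1 hz.1).contDiffAt (h₁.isOpen.mem_nhds hz.1)).differentiableAt
    (by norm_num)).hasFDerivAt.pow 2).comp z hasFDerivAt_fst
  have e2 := DFunLike.congr_fun (e1.unique (k₁.add (k.mul k₂))) u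
  simp only [ContinuousLinearMap.flip_apply] at e2
  rw [e2]
  simp [pullbackForm_apply]
  ring

/-- The Levi-Civita connection of a warped product: the base component sees the fibre through
`-f G₂(v, w) grad f`, the fibre component sees the base through `d (log f)`. -/
theorem christoffel_warpedCoord (h₁ : IsMetricOn G₁ U₁) (h₂ : IsMetricOn G₂ U₂)
    (hf : ContDiffOn ℝ 2 f U₁) (hf0 : ∀ x ∈ U₁, f x ≠ 0) {z : E₁ × E₂} (hz : z ∈ U₁ ×ˢ U₂)
    (v w : E₁ × E₂) :
    christoffel (warpedCoord G₁ f G₂) z v w =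
      (christoffel G₁ z.1 v.1 w.1 - (f z.1 * G₂ z.2 v.2 w.2) • gradCoord G₁ f z.1,
        christoffel G₂ z.2 v.2 w.2 + (fderiv ℝ f z.1 v.1 / f z.1) • w.2 +
          (fderiv ℝ f z.1 w.1 / f z.1) • v.2) := by
  have h := h₁.warpedCoord h₂ hf hf0
  rw [christoffel_apply, (h.isInvertible hz).inverse_apply_eq]
  refine ContinuousLinearMap.ext fun u ↦ ?_
  have := hf0 _ hz.1
  simp only [warpedCoord_apply, christoffelLower_apply, fderiv_warpedCoord h₁ h₂ hf hf0 hz, map_sub,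
    map_add, map_smul, sub_apply, add_apply, smul_apply, h₁.apply_christoffel hz.1,
    h₂.apply_christoffel hz.2, h₁.apply_gradCoord hz.1, smul_eq_mul]
  rw [h₂.symm _ hz.2 v.2 u.2, h₂.symm _ hz.2 w.2 u.2, h₂.symm _ hz.2 v.2 w.2,
    h₂.symm _ hz.2 w.2 v.2]
  field_simp
  ring

/-! ### The Ricci tensor of a warped product -/

theorem curvatureEndo_apply {E : Type*} [NormedAddCommGroup E] [NormedSpace ℝ E]
    (G : E → E →L[ℝ] E →L[ℝ] ℝ) (z v w u : E) :
    curvatureEndo G z v w u = fderiv ℝ (christoffel G) z u v w - fderiv ℝ (christoffel G) z v u w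
      + christoffel G z u (christoffel G z v w) - christoffel G z v (christoffel G z u w) := rfl

/-- Differentiating the Christoffel symbols of a warped product reduces to differentiating any
local expression for them. -/
theorem fderiv_christoffel_warpedCoord (h₁ : IsMetricOn G₁ U₁) (h₂ : IsMetricOn G₂ U₂)
    (hf : ContDiffOn ℝ 2 f U₁) (hf0 : ∀ x ∈ U₁, f x ≠ 0) {z : E₁ × E₂} (hz : z ∈ U₁ ×ˢ U₂)
    {v w : E₁ × E₂} {F : E₁ × E₂ → E₁ × E₂} {F' : (E₁ × E₂) →L[ℝ] (E₁ × E₂)}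
    (hF : ∀ y ∈ U₁ ×ˢ U₂, christoffel (warpedCoord G₁ f G₂) y v w = F y)
    (hF' : HasFDerivAt F F' z) (u : E₁ × E₂) :
    fderiv ℝ (christoffel (warpedCoord G₁ f G₂)) z u v w = F' u := by
  have h := h₁.warpedCoord h₂ hf hf0
  have e1 : (fun y ↦ christoffel (warpedCoord G₁ f G₂) y v w) =ᶠ[𝓝 z] F := by
    filter_upwards [h.isOpen.mem_nhds hz] with y hy using hF y hy
  have e2 := hasFDerivAt_apply_apply (h.differentiableAt_christoffel hz) v w
  exact DFunLike.congr_fun (e2.unique (hF'.congr_of_eventuallyEq e1)) u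

theorem fderiv_christoffel_warpedCoord_horizontal (h₁ : IsMetricOn G₁ U₁) (h₂ : IsMetricOn G₂ U₂)
    (hf : ContDiffOn ℝ 2 f U₁) (hf0 : ∀ x ∈ U₁, f x ≠ 0) {z : E₁ × E₂} (hz : z ∈ U₁ ×ˢ U₂)
    (u : E₁ × E₂) (v w : E₁) :
    fderiv ℝ (christoffel (warpedCoord G₁ f G₂)) z u (v, 0) (w, 0) =
      (fderiv ℝ (christoffel G₁) z.1 u.1 v w, 0) := by
  have k := hasFDerivAt_apply_apply (h₁.differentiableAt_christoffel hz.1) v w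
  rw [fderiv_christoffel_warpedCoord h₁ h₂ hf hf0 hz
    (F := fun y ↦ (christoffel G₁ y.1 v w, 0)) (fun y hy ↦ by
      simp [christoffel_warpedCoord h₁ h₂ hf hf0 hy])
    ((k.comp z hasFDerivAt_fst).prodMk (hasFDerivAt_const 0 z))]
  simp

/-- The factor is the derivative `∂ᵤ (∂ᵥ f / f)` of the coefficient of `w` in
`Γ(v, w) = (∂ᵥ f / f) w`. -/
theorem fderiv_christoffel_warpedCoord_mixed (h₁ : IsMetricOn G₁ U₁) (h₂ : IsMetricOn G₂ U₂)
    (hf : ContDiffOn ℝ 2 f U₁) (hf0 : ∀ x ∈ U₁, f x ≠ 0) {z : E₁ × E₂} (hz : z ∈ U₁ ×ˢ U₂)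
    (u : E₁ × E₂) (v : E₁) (w : E₂) :
    fderiv ℝ (christoffel (warpedCoord G₁ f G₂)) z u (v, 0) (0, w) =
        (0, (fderiv ℝ (fderiv ℝ f) z.1 u.1 v / f z.1 -
          fderiv ℝ f z.1 u.1 * fderiv ℝ f z.1 v / f z.1 ^ 2) • w) ∧
      fderiv ℝ (christoffel (warpedCoord G₁ f G₂)) z u (0, w) (v, 0) =
        (0, (fderiv ℝ (fderiv ℝ f) z.1 u.1 v / f z.1 -
          fderiv ℝ f z.1 u.1 * fderiv ℝ f z.1 v / f z.1 ^ 2) • w) := by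
  have hf2 := (hf z.1 hz.1).contDiffAt (h₁.isOpen.mem_nhds hz.1)
  have k₁ := (hf2.differentiableAt (by norm_num)).hasFDerivAt
  have k₂ := ((hf2.fderiv_right (m := 1) (by norm_num)).differentiableAt
    (by norm_num)).hasFDerivAt.clm_apply (hasFDerivAt_const v z.1)
  have hne := hf0 _ hz.1
  have k : HasFDerivAt (fun y : E₁ × E₂ ↦ ((0 : E₁), (fderiv ℝ f y.1 v * (f y.1)⁻¹) • w)) _ z :=
    (hasFDerivAt_const 0 z).prodMk
      (((k₂.mul ((hasDerivAt_inv hne).comp_hasFDerivAt z.1 k₁)).comp z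
        hasFDerivAt_fst).smul_const w)
  constructor
  · rw [fderiv_christoffel_warpedCoord h₁ h₂ hf hf0 hz (fun y hy ↦ by
      simp [christoffel_warpedCoord h₁ h₂ hf hf0 hy, div_eq_mul_inv]) k]
    simp
    congr 1
    field_simp
    ring
  · rw [fderiv_christoffel_warpedCoord h₁ h₂ hf hf0 hz (fun y hy ↦ by
      simp [christoffel_warpedCoord h₁ h₂ hf hf0 hy, div_eq_mul_inv]) k]
    simp
    congr 1
    field_simp
    ring

theorem fderiv_christoffel_warpedCoord_vertical (h₁ : IsMetricOn G₁ U₁) (h₂ : IsMetricOn G₂ U₂)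
    (hf : ContDiffOn ℝ 2 f U₁) (hf0 : ∀ x ∈ U₁, f x ≠ 0) {z : E₁ × E₂} (hz : z ∈ U₁ ×ˢ U₂)
    (u : E₁ × E₂) (v w : E₂) :
    fderiv ℝ (christoffel (warpedCoord G₁ f G₂)) z u (0, v) (0, w) =
      (-((f z.1 * G₂ z.2 v w) • fderiv ℝ (gradCoord G₁ f) z.1 u.1 +
        (fderiv ℝ f z.1 u.1 * G₂ z.2 v w + f z.1 * fderiv ℝ G₂ z.2 u.2 v w) •
          gradCoord G₁ f z.1), fderiv ℝ (christoffel G₂) z.2 u.2 v w) := by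
  have hf2 := (hf z.1 hz.1).contDiffAt (h₁.isOpen.mem_nhds hz.1)
  have k₁ := ((hf2.differentiableAt (by norm_num)).hasFDerivAt).comp z hasFDerivAt_fst
  have k₂ := (hasFDerivAt_apply_apply (h₂.differentiableAt hz.2) v w).comp z hasFDerivAt_snd
  have k₃ := ((h₁.differentiableAt_gradCoord hz.1 hf2).hasFDerivAt).comp z hasFDerivAt_fst
  have k₄ := hasFDerivAt_apply_apply (h₂.differentiableAt_christoffel hz.2) v w
  rw [fderiv_christoffel_warpedCoord h₁ h₂ hf hf0 hz
    (F := fun y ↦ (-((f y.1 * G₂ y.2 v w) • gradCoord G₁ f y.1), christoffel G₂ y.2 v w))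
    (fun y hy ↦ by simp [christoffel_warpedCoord h₁ h₂ hf hf0 hy])
    (((k₁.mul k₂).smul k₃).neg.prodMk (k₄.comp z hasFDerivAt_snd))]
  simp only [ContinuousLinearMap.prod_apply, neg_apply, add_apply, smul_apply,
    ContinuousLinearMap.comp_apply, ContinuousLinearMap.smulRight_apply,
    ContinuousLinearMap.flip_apply, ContinuousLinearMap.coe_fst', ContinuousLinearMap.coe_snd',
    smul_eq_mul, Function.comp_apply]
  congr 4
  ring

/-- The Ricci tensor of a warped product on vectors tangent to the base. The base block of
`u ↦ R(u, v) w` is the curvature of `G₁`; the fibre block is `-(Hess f (v, w) / f)` times the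
identity. -/
theorem ricciCoord_warpedCoord_horizontal (h₁ : IsMetricOn G₁ U₁) (h₂ : IsMetricOn G₂ U₂)
    (hf : ContDiffOn ℝ 2 f U₁) (hf0 : ∀ x ∈ U₁, f x ≠ 0) {z : E₁ × E₂} (hz : z ∈ U₁ ×ˢ U₂)
    (v w : E₁) :
    ricciCoord (warpedCoord G₁ f G₂) z (v, 0) (w, 0) = ricciCoord G₁ z.1 v w -
      Module.finrank ℝ E₂ / f z.1 * hessianCoord G₁ f z.1 v w := by
  have hne := hf0 _ hz.1
  have b₁ : LinearMap.fst ℝ E₁ E₂ ∘ₗ curvatureEndo (warpedCoord G₁ f G₂) z (v, 0) (w, 0) ∘ₗ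
      LinearMap.inl ℝ E₁ E₂ = curvatureEndo G₁ z.1 v w := by
    ext u
    simp [curvatureEndo_apply, fderiv_christoffel_warpedCoord_horizontal h₁ h₂ hf hf0 hz,
      christoffel_warpedCoord h₁ h₂ hf hf0 hz]
  have b₂ : LinearMap.snd ℝ E₁ E₂ ∘ₗ curvatureEndo (warpedCoord G₁ f G₂) z (v, 0) (w, 0) ∘ₗ
      LinearMap.inr ℝ E₁ E₂ = (-(hessianCoord G₁ f z.1 v w / f z.1)) • LinearMap.id := by
    ext u
    have e : fderiv ℝ (christoffel (warpedCoord G₁ f G₂)) z (0, u) (v, 0) (w, 0) = 0 := by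
      simp [fderiv_christoffel_warpedCoord_horizontal h₁ h₂ hf hf0 hz]
    simp only [LinearMap.comp_apply, LinearMap.inr_apply, LinearMap.snd_apply, curvatureEndo_apply,
      e, (fderiv_christoffel_warpedCoord_mixed h₁ h₂ hf hf0 hz _ _ _).2,
      christoffel_warpedCoord h₁ h₂ hf hf0 hz, hessianCoord_apply, Prod.snd_add, Prod.snd_sub,
      Prod.snd_zero, map_zero, zero_apply, smul_zero, LinearMap.smul_apply, LinearMap.id_apply,
      mul_zero, zero_smul, sub_zero, zero_add, add_zero, zero_div, smul_smul]
    match_scalars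
    field_simp
    ring
  rw [ricciCoord, trace_prod_eq_add, b₁, b₂, map_smul, LinearMap.trace_id, ricciCoord, smul_eq_mul]
  ring

/-- The Ricci tensor of a warped product on vectors tangent to the fibre. The base block of
`u ↦ R(u, v) w` is `-f G₂(v, w)` times the Hessian of `f` with one index raised; the fibre block is
`R₂(u, v) w - |grad f|² (G₂(v, w) u - G₂(u, w) v)`. -/
theorem ricciCoord_warpedCoord_vertical (h₁ : IsMetricOn G₁ U₁) (h₂ : IsMetricOn G₂ U₂)
    (hf : ContDiffOn ℝ 2 f U₁) (hf0 : ∀ x ∈ U₁, f x ≠ 0) {z : E₁ × E₂} (hz : z ∈ U₁ ×ˢ U₂)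
    (v w : E₂) :
    ricciCoord (warpedCoord G₁ f G₂) z (0, v) (0, w) = ricciCoord G₂ z.2 v w -
      (f z.1 * LinearMap.trace ℝ E₁ ((G₁ z.1).inverse ∘L hessianCoord G₁ f z.1 : E₁ →L[ℝ] E₁) +
        (Module.finrank ℝ E₂ - 1) * fderiv ℝ f z.1 (gradCoord G₁ f z.1)) * G₂ z.2 v w := by
  have hne := hf0 _ hz.1
  have hf2 := (hf z.1 hz.1).contDiffAt (h₁.isOpen.mem_nhds hz.1)
  have b₁ : LinearMap.fst ℝ E₁ E₂ ∘ₗ curvatureEndo (warpedCoord G₁ f G₂) z (0, v) (0, w) ∘ₗ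
      LinearMap.inl ℝ E₁ E₂ = (-(f z.1 * G₂ z.2 v w)) •
        (((G₁ z.1).inverse ∘L hessianCoord G₁ f z.1 : E₁ →L[ℝ] E₁) : E₁ →ₗ[ℝ] E₁) := by
    ext u
    have e := h₁.fderiv_gradCoord_add_christoffel hz.1 hf2 u
    simp only [LinearMap.smul_apply, ContinuousLinearMap.coe_coe, ContinuousLinearMap.comp_apply,
      ← e]
    simp only [LinearMap.comp_apply, LinearMap.inl_apply, LinearMap.fst_apply, curvatureEndo_apply,
      fderiv_christoffel_warpedCoord_vertical h₁ h₂ hf hf0 hz,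
      (fderiv_christoffel_warpedCoord_mixed h₁ h₂ hf hf0 hz _ _ _).1,
      christoffel_warpedCoord h₁ h₂ hf hf0 hz, Prod.fst_add, Prod.fst_sub, map_zero,
      zero_apply, smul_zero, mul_zero, zero_smul, sub_zero, zero_add, add_zero, zero_div, zero_sub,
      map_neg, map_smul, smul_eq_mul, neg_smul]
    match_scalars
    all_goals field_simp
    ring
  have b₂ : LinearMap.snd ℝ E₁ E₂ ∘ₗ curvatureEndo (warpedCoord G₁ f G₂) z (0, v) (0, w) ∘ₗ
      LinearMap.inr ℝ E₁ E₂ = curvatureEndo G₂ z.2 v w - fderiv ℝ f z.1 (gradCoord G₁ f z.1) •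
        (G₂ z.2 v w • LinearMap.id - ((G₂ z.2).flip w : E₂ →ₗ[ℝ] ℝ).smulRight v) := by
    ext u
    simp only [LinearMap.comp_apply, LinearMap.inr_apply, LinearMap.snd_apply, curvatureEndo_apply,
      fderiv_christoffel_warpedCoord_vertical h₁ h₂ hf hf0 hz,
      christoffel_warpedCoord h₁ h₂ hf hf0 hz, Prod.snd_add, Prod.snd_sub, map_zero,
      zero_apply, smul_zero, zero_smul, zero_add, add_zero, zero_div, zero_sub,
      map_neg, map_smul, smul_eq_mul, LinearMap.sub_apply, LinearMap.smul_apply,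
      LinearMap.id_apply, LinearMap.smulRight_apply, ContinuousLinearMap.coe_coe,
      ContinuousLinearMap.flip_apply]
    match_scalars <;> field_simp
  rw [ricciCoord, trace_prod_eq_add, b₁, b₂, map_smul, map_sub, map_smul, map_sub, map_smul,
    LinearMap.trace_id, LinearMap.trace_smulRight, ricciCoord]
  simp only [smul_eq_mul, ContinuousLinearMap.coe_coe, ContinuousLinearMap.flip_apply]
  ring

end WarpedCoordinates

/-! ### Passing to preferred charts -/

section Charts

open Filter Topology

variable {E : Type*} [NormedAddCommGroup E] [NormedSpace ℝ E]
  {H : Type*} [TopologicalSpace H] (I : ModelWithCorners ℝ E H)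
  {M : Type*} [TopologicalSpace M] [ChartedSpace H M]

theorem contDiffOn_comp_extChartAt_symm [IsManifold I ∞ M] {f : M → ℝ}
    (hf : ContMDiff I 𝓘(ℝ, ℝ) ∞ f) (p : M) :
    ContDiffOn ℝ 2 (f ∘ (extChartAt I p).symm) (extChartAt I p).target :=
  ((hf.comp_contMDiffOn (contMDiffOn_extChartAt_symm (n := ∞) p)).contDiffOn).of_le ENat.LEInfty.out

variable [I.Boundaryless]

theorem mdifferentiableAt_extChartAt_symm [IsManifold I ∞ M] (p : M) {z : E}
    (hz : z ∈ (extChartAt I p).target) :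
    MDifferentiableAt 𝓘(ℝ, E) I (extChartAt I p).symm z :=
  ((contMDiffOn_extChartAt_symm (n := ∞) p z hz).contMDiffAt
    ((isOpen_extChartAt_target p).mem_nhds hz)).mdifferentiableAt (by simp)

/-- In the preferred chart at `x`, the inverse chart has the identity as derivative at the base
point, by the definition of `TangentSpace`. -/
theorem mfderiv_extChartAt_symm_self [IsManifold I ∞ M] (x : M) :
    (mfderiv 𝓘(ℝ, E) I (extChartAt I x).symm (extChartAt I x x) : E →L[ℝ] E) =
      ContinuousLinearMap.id ℝ E := by
  have h := mdifferentiableAt_extChartAt_symm I x (mem_extChartAt_target (I := I) x)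
  refine h.mfderiv.trans ?_
  change fderivWithin ℝ (extChartAt I ((extChartAt I x).symm (extChartAt I x x)) ∘
    (extChartAt I x).symm) (range id) (extChartAt I x x) = _
  rw [range_id, fderivWithin_univ, extChartAt_to_inv]
  have : (extChartAt I x ∘ (extChartAt I x).symm) =ᶠ[𝓝 (extChartAt I x x)] id := by
    filter_upwards [(isOpen_extChartAt_target (I := I) x).mem_nhds (mem_extChartAt_target x)]
      with z hz using (extChartAt I x).right_inv hz
  rw [this.fderiv_eq, fderiv_id]

/-- At the base point, a metric and its expression in the preferred chart agree. -/
theorem inChart_self [IsManifold I ∞ M] (g : FormField I M) (x : M) :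
    inChart I g x (extChartAt I x x) = g x := by
  refine ContinuousLinearMap.ext fun v ↦ ContinuousLinearMap.ext fun w ↦ ?_
  have h1 (a : E) : mfderiv 𝓘(ℝ, E) I (extChartAt I x).symm (extChartAt I x x) a = a :=
    DFunLike.congr_fun (mfderiv_extChartAt_symm_self I x) a
  change g ((extChartAt I x).symm (extChartAt I x x)) (mfderiv 𝓘(ℝ, E) I (extChartAt I x).symm
    (extChartAt I x x) v) (mfderiv 𝓘(ℝ, E) I (extChartAt I x).symm (extChartAt I x x) w) = _
  rw [h1 v, h1 w, extChartAt_to_inv]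
  rfl

theorem mfderiv_eq_fderiv_comp_symm {f : M → ℝ} {x : M} (hf : MDifferentiableAt I 𝓘(ℝ, ℝ) f x) :
    (mfderiv I 𝓘(ℝ, ℝ) f x : E →L[ℝ] ℝ) =
      fderiv ℝ (f ∘ (extChartAt I x).symm) (extChartAt I x x) := by
  refine hf.mfderiv.trans ?_
  rw [I.range_eq_univ, fderivWithin_univ]
  rfl

theorem contMDiffOn_mfderiv_extChartAt_symm [IsManifold I ∞ M] (p : M) (e : E) :
    ContMDiffOn 𝓘(ℝ, E) I.tangent ∞ (fun z ↦ (Bundle.TotalSpace.mk' E ((extChartAt I p).symm z)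
      (mfderiv 𝓘(ℝ, E) I (extChartAt I p).symm z e) : TangentBundle I M))
      (extChartAt I p).target := by
  have hU : IsOpen (extChartAt I p).target := isOpen_extChartAt_target p
  have h1 := (contMDiffOn_extChartAt_symm (I := I) (n := ∞) p).contMDiffOn_tangentMapWithin
    (m := ∞) (by simp) hU.uniqueMDiffOn
  have h2 : ContMDiffOn 𝓘(ℝ, E) 𝓘(ℝ, E).tangent ∞
      (fun z : E ↦ (⟨z, e⟩ : TangentBundle 𝓘(ℝ, E) E)) (extChartAt I p).target :=
    contMDiffOn_vectorSpace_iff_contDiffOn.2 contDiffOn_const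
  refine (h1.comp h2 fun z hz ↦ hz).congr fun z hz ↦ ?_
  simp only [Function.comp, tangentMapWithin, mfderivWithin_of_isOpen hU hz]

/-- A smooth Riemannian metric on a manifold is a metric on the target of each preferred chart. -/
theorem IsRiemannianMetric.isMetricOn [FiniteDimensional ℝ E] [IsManifold I ∞ M]
    {g : FormField I M} (hg : IsRiemannianMetric I g) (p : M) :
    IsMetricOn (inChart I g p) (extChartAt I p).target where
  isOpen := isOpen_extChartAt_target p
  contDiffOn := by
    rw [contDiffOn_clm_apply]
    intro v
    rw [contDiffOn_clm_apply]
    intro w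
    have h : ContMDiffOn 𝓘(ℝ, E) (I.prod 𝓘(ℝ, ℝ)) ∞
        (fun z ↦ Bundle.TotalSpace.mk' ℝ (E := Bundle.Trivial M ℝ) ((extChartAt I p).symm z)
          (g ((extChartAt I p).symm z) (mfderiv 𝓘(ℝ, E) I (extChartAt I p).symm z v)
            (mfderiv 𝓘(ℝ, E) I (extChartAt I p).symm z w))) (extChartAt I p).target := by
      apply ContMDiffOn.clm_bundle_apply₂ (F₁ := E) (F₂ := E)
      · exact hg.smooth.comp_contMDiffOn (contMDiffOn_extChartAt_symm (n := ∞) p)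
      · exact contMDiffOn_mfderiv_extChartAt_symm I p v
      · exact contMDiffOn_mfderiv_extChartAt_symm I p w
    have h2 : ContMDiffOn 𝓘(ℝ, E) 𝓘(ℝ, ℝ) ∞ (fun z ↦ inChart I g p z v w)
        (extChartAt I p).target := by
      intro z hz
      have := h z hz
      simp only [Bundle.contMDiffWithinAt_totalSpace] at this
      exact this.2
    exact h2.contDiffOn.of_le ENat.LEInfty.out
  symm z _ v w := hg.symm _ _ _
  pos z hz v hv := by
    refine hg.pos _ _ fun h0 ↦ hv ?_
    -- the inverse chart is an immersion: the chart is a left inverse of it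
    have h1 := mfderiv_extChartAt_comp_mfderivWithin_extChartAt_symm (I := I) hz
    rw [I.range_eq_univ, mfderivWithin_univ] at h1
    have h2 : mfderiv I 𝓘(ℝ, E) (extChartAt I p) ((extChartAt I p).symm z)
        (mfderiv 𝓘(ℝ, E) I (extChartAt I p).symm z v) = v := DFunLike.congr_fun h1 v
    exact h2.symm.trans ((congrArg _ h0).trans (map_zero _))

end Charts

/-! ### Warped products in product charts -/

section WarpedCharts

open Filter Topology

variable {E₁ : Type*} [NormedAddCommGroup E₁] [NormedSpace ℝ E₁]
  {H₁ : Type*} [TopologicalSpace H₁] (I₁ : ModelWithCorners ℝ E₁ H₁)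
  {M₁ : Type*} [TopologicalSpace M₁] [ChartedSpace H₁ M₁]
  {E₂ : Type*} [NormedAddCommGroup E₂] [NormedSpace ℝ E₂]
  {H₂ : Type*} [TopologicalSpace H₂] (I₂ : ModelWithCorners ℝ E₂ H₂)
  {M₂ : Type*} [TopologicalSpace M₂] [ChartedSpace H₂ M₂]

theorem warpedProduct_apply (g₁ : FormField I₁ M₁) (lam : M₁ → ℝ) (g₂ : FormField I₂ M₂)
    (p : M₁ × M₂) (v w : TangentSpace (I₁.prod I₂) p) :
    warpedProduct I₁ I₂ g₁ lam g₂ p v w =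
      g₁ p.1 (v : E₁ × E₂).1 (w : E₁ × E₂).1 +
        lam p.1 ^ 2 * g₂ p.2 (v : E₁ × E₂).2 (w : E₁ × E₂).2 := by
  rw [warpedProduct, mfderiv_fst, mfderiv_snd]
  rfl

theorem warpedProduct_horizontal (g₁ : FormField I₁ M₁) (lam : M₁ → ℝ) (g₂ : FormField I₂ M₂)
    (x : M₁) (y : M₂) (v w : TangentSpace I₁ x) :
    warpedProduct I₁ I₂ g₁ lam g₂ (x, y) ((v, 0) : E₁ × E₂) ((w, 0) : E₁ × E₂) = g₁ x v w := by
  refine (warpedProduct_apply I₁ I₂ g₁ lam g₂ (x, y) _ _).trans ?_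
  change g₁ x v w + lam x ^ 2 * g₂ y 0 0 = _
  simp

theorem warpedProduct_vertical (g₁ : FormField I₁ M₁) (lam : M₁ → ℝ) (g₂ : FormField I₂ M₂)
    (x : M₁) (y : M₂) (v w : TangentSpace I₂ y) :
    warpedProduct I₁ I₂ g₁ lam g₂ (x, y) ((0, v) : E₁ × E₂) ((0, w) : E₁ × E₂) =
      lam x ^ 2 * g₂ y v w := by
  refine (warpedProduct_apply I₁ I₂ g₁ lam g₂ (x, y) _ _).trans ?_
  change g₁ x 0 0 + lam x ^ 2 * g₂ y v w = _
  simp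

variable [I₁.Boundaryless] [I₂.Boundaryless] [IsManifold I₁ ∞ M₁] [IsManifold I₂ ∞ M₂]

theorem mfderiv_extChartAt_prod_symm (p : M₁ × M₂) {z : E₁ × E₂}
    (hz : z ∈ (extChartAt (I₁.prod I₂) p).target) (v : E₁ × E₂) :
    (mfderiv 𝓘(ℝ, E₁ × E₂) (I₁.prod I₂) (extChartAt (I₁.prod I₂) p).symm z v : E₁ × E₂) =
      (mfderiv 𝓘(ℝ, E₁) I₁ (extChartAt I₁ p.1).symm z.1 v.1,
        mfderiv 𝓘(ℝ, E₂) I₂ (extChartAt I₂ p.2).symm z.2 v.2) := by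
  have hz' := hz
  rw [extChartAt_prod] at hz'
  have h := mdifferentiableAt_extChartAt_symm (I₁.prod I₂) p hz
  have d₁ := mdifferentiableAt_extChartAt_symm I₁ p.1 hz'.1
  have d₂ := mdifferentiableAt_extChartAt_symm I₂ p.2 hz'.2
  -- both projections of the inverse product chart factor through a projection of `E₁ × E₂`
  have e₁ : (Prod.fst : M₁ × M₂ → M₁) ∘ (extChartAt (I₁.prod I₂) p).symm =
      (extChartAt I₁ p.1).symm ∘ (Prod.fst : E₁ × E₂ → E₁) := by
    rw [extChartAt_prod]; rfl
  have e₂ : (Prod.snd : M₁ × M₂ → M₂) ∘ (extChartAt (I₁.prod I₂) p).symm =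
      (extChartAt I₂ p.2).symm ∘ (Prod.snd : E₁ × E₂ → E₂) := by
    rw [extChartAt_prod]; rfl
  have f₁ : HasMFDerivAt 𝓘(ℝ, E₁ × E₂) 𝓘(ℝ, E₁) (Prod.fst : E₁ × E₂ → E₁) z
    (ContinuousLinearMap.fst ℝ E₁ E₂) := hasFDerivAt_fst.hasMFDerivAt
  have f₂ : HasMFDerivAt 𝓘(ℝ, E₁ × E₂) 𝓘(ℝ, E₂) (Prod.snd : E₁ × E₂ → E₂) z
    (ContinuousLinearMap.snd ℝ E₁ E₂) := hasFDerivAt_snd.hasMFDerivAt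
  have l₁ := (hasMFDerivAt_fst (I := I₁) (I' := I₂)
    ((extChartAt (I₁.prod I₂) p).symm z)).comp z h.hasMFDerivAt
  have l₂ := (hasMFDerivAt_snd (I := I₁) (I' := I₂)
    ((extChartAt (I₁.prod I₂) p).symm z)).comp z h.hasMFDerivAt
  rw [e₁] at l₁
  rw [e₂] at l₂
  have c₁ := hasMFDerivAt_unique l₁ (d₁.hasMFDerivAt.comp z f₁)
  have c₂ := hasMFDerivAt_unique l₂ (d₂.hasMFDerivAt.comp z f₂)
  exact Prod.ext (DFunLike.congr_fun c₁ v) (DFunLike.congr_fun c₂ v)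

/-- In a product chart, a warped product is the warped product of the factors in their charts. -/
theorem inChart_warpedProduct (g₁ : FormField I₁ M₁) (lam : M₁ → ℝ) (g₂ : FormField I₂ M₂)
    (p : M₁ × M₂) {z : E₁ × E₂} (hz : z ∈ (extChartAt (I₁.prod I₂) p).target) :
    inChart (I₁.prod I₂) (warpedProduct I₁ I₂ g₁ lam g₂) p z =
      warpedCoord (inChart I₁ g₁ p.1) (lam ∘ (extChartAt I₁ p.1).symm) (inChart I₂ g₂ p.2) z := by
  refine ContinuousLinearMap.ext fun v ↦ ContinuousLinearMap.ext fun w ↦ ?_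
  have hv := mfderiv_extChartAt_prod_symm I₁ I₂ p hz v
  have hw := mfderiv_extChartAt_prod_symm I₁ I₂ p hz w
  refine (warpedProduct_apply I₁ I₂ g₁ lam g₂ _ _ _).trans ?_
  exact congrArg₂ (fun a b : E₁ × E₂ ↦
    (g₁ ((extChartAt I₁ p.1).symm z.1) : E₁ →L[ℝ] E₁ →L[ℝ] ℝ) a.1 b.1 +
      lam ((extChartAt I₁ p.1).symm z.1) ^ 2 *
        (g₂ ((extChartAt I₂ p.2).symm z.2) : E₂ →L[ℝ] E₂ →L[ℝ] ℝ) a.2 b.2) hv hw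

end WarpedCharts

/-! ### The Ricci tensor of a warped product of manifolds -/

section WarpedRicci

variable {E : Type*} [NormedAddCommGroup E] [NormedSpace ℝ E]
  {H : Type*} [TopologicalSpace H] (I : ModelWithCorners ℝ E H) [I.Boundaryless]
  {M : Type*} [TopologicalSpace M] [ChartedSpace H M] [IsManifold I ∞ M]

theorem laplacian_eq_trace (g : FormField I M) (f : M → ℝ) (x : M) :
    laplacian I g f x = LinearMap.trace ℝ E ((inChart I g x (extChartAt I x x)).inverse ∘L
      hessianCoord (inChart I g x) (f ∘ (extChartAt I x).symm) (extChartAt I x x) :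
        E →L[ℝ] E) := by
  rw [inChart_self]
  rfl

theorem gradNormSq_eq_fderiv_gradCoord [FiniteDimensional ℝ E] {g : FormField I M}
    (hg : IsRiemannianMetric I g) {f : M → ℝ} {x : M} (hf : MDifferentiableAt I 𝓘(ℝ, ℝ) f x) :
    gradNormSq I g f x = fderiv ℝ (f ∘ (extChartAt I x).symm) (extChartAt I x x)
      (gradCoord (inChart I g x) (f ∘ (extChartAt I x).symm) (extChartAt I x x)) := by
  have e : (grad I g f x : E) =
      gradCoord (inChart I g x) (f ∘ (extChartAt I x).symm) (extChartAt I x x) := by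
    rw [gradCoord, inChart_self, ← mfderiv_eq_fderiv_comp_symm I hf]
    rfl
  rw [← (hg.isMetricOn I x).apply_gradCoord (mem_extChartAt_target x), inChart_self, ← e]
  rfl

variable {E₁ : Type*} [NormedAddCommGroup E₁] [NormedSpace ℝ E₁]
  {H₁ : Type*} [TopologicalSpace H₁] (I₁ : ModelWithCorners ℝ E₁ H₁) [I₁.Boundaryless]
  {M₁ : Type*} [TopologicalSpace M₁] [ChartedSpace H₁ M₁] [IsManifold I₁ ∞ M₁]
  {E₂ : Type*} [NormedAddCommGroup E₂] [NormedSpace ℝ E₂]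
  {H₂ : Type*} [TopologicalSpace H₂] (I₂ : ModelWithCorners ℝ E₂ H₂) [I₂.Boundaryless]
  {M₂ : Type*} [TopologicalSpace M₂] [ChartedSpace H₂ M₂] [IsManifold I₂ ∞ M₂]
  {g₁ : FormField I₁ M₁} {lam : M₁ → ℝ} {g₂ : FormField I₂ M₂}

/-- The Ricci tensor of a warped product at `(x, y)` can be computed from the warped product of the
coordinate expressions of the two factors. -/
theorem ricci_warpedProduct_eq_ricciCoord (x : M₁) (y : M₂) (v w : E₁ × E₂) :
    ricci (I₁.prod I₂) (warpedProduct I₁ I₂ g₁ lam g₂) (x, y) v w =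
      ricciCoord (warpedCoord (inChart I₁ g₁ x) (lam ∘ (extChartAt I₁ x).symm) (inChart I₂ g₂ y))
        (extChartAt I₁ x x, extChartAt I₂ y y) v w := by
  refine ricciCoord_congr (z := extChartAt (I₁.prod I₂) (x, y) (x, y)) ?_ v w
  have hU : (extChartAt (I₁.prod I₂) (x, y)).target ∈
      nhds (extChartAt (I₁.prod I₂) (x, y) (x, y)) :=
    (isOpen_extChartAt_target (I := I₁.prod I₂) (x, y)).mem_nhds (mem_extChartAt_target (x, y))
  filter_upwards [hU] with z hz using inChart_warpedProduct I₁ I₂ g₁ lam g₂ (x, y) hz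

variable [FiniteDimensional ℝ E₁] [FiniteDimensional ℝ E₂]

/-- `Ric(X, Y) = Ric₁(X, Y) - (m₂ / λ) Hess λ (X, Y)` for `X`, `Y` tangent to the base. -/
theorem ricci_warpedProduct_horizontal (hg₁ : IsRiemannianMetric I₁ g₁)
    (hlam : ContMDiff I₁ 𝓘(ℝ, ℝ) ∞ lam) (hlam0 : ∀ x, lam x ≠ 0) (hg₂ : IsRiemannianMetric I₂ g₂)
    (x : M₁) (y : M₂) (v w : TangentSpace I₁ x) :
    ricci (I₁.prod I₂) (warpedProduct I₁ I₂ g₁ lam g₂) (x, y) ((v, 0) : E₁ × E₂)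
        ((w, 0) : E₁ × E₂) =
      ricci I₁ g₁ x v w - Module.finrank ℝ E₂ / lam x * hessian I₁ g₁ lam x v w := by
  have h := ricciCoord_warpedCoord_horizontal (hg₁.isMetricOn I₁ x) (hg₂.isMetricOn I₂ y)
    (contDiffOn_comp_extChartAt_symm I₁ hlam x) (fun _ _ ↦ hlam0 _)
    (z := (extChartAt I₁ x x, extChartAt I₂ y y))
    ⟨mem_extChartAt_target x, mem_extChartAt_target y⟩ v w
  rw [Function.comp_apply, extChartAt_to_inv] at h
  exact (ricci_warpedProduct_eq_ricciCoord I₁ I₂ x y _ _).trans h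

/-- `Ric(V, W) = Ric₂(V, W) - (λ Δλ + (m₂ - 1) |grad λ|²) g₂(V, W)` for `V`, `W` tangent to the
fibre, with `λ Δλ` written as `Δλ² / 2 - |grad λ|²`. -/
theorem ricci_warpedProduct_vertical (hg₁ : IsRiemannianMetric I₁ g₁)
    (hlam : ContMDiff I₁ 𝓘(ℝ, ℝ) ∞ lam) (hlam0 : ∀ x, lam x ≠ 0) (hg₂ : IsRiemannianMetric I₂ g₂)
    (x : M₁) (y : M₂) (v w : TangentSpace I₂ y) :
    ricci (I₁.prod I₂) (warpedProduct I₁ I₂ g₁ lam g₂) (x, y) ((0, v) : E₁ × E₂)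
        ((0, w) : E₁ × E₂) =
      ricci I₂ g₂ y v w - (laplacian I₁ g₁ (fun x ↦ lam x ^ 2) x / 2 +
        (Module.finrank ℝ E₂ - 2) * gradNormSq I₁ g₁ lam x) * g₂ y v w := by
  have h := ricciCoord_warpedCoord_vertical (hg₁.isMetricOn I₁ x) (hg₂.isMetricOn I₂ y)
    (contDiffOn_comp_extChartAt_symm I₁ hlam x) (fun _ _ ↦ hlam0 _)
    (z := (extChartAt I₁ x x, extChartAt I₂ y y))
    ⟨mem_extChartAt_target x, mem_extChartAt_target y⟩ v w
  have hsq := trace_inverse_hessianCoord_sq (G := inChart I₁ g₁ x)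
    ((contDiffOn_comp_extChartAt_symm I₁ hlam x).contDiffAt
      ((isOpen_extChartAt_target (I := I₁) x).mem_nhds (mem_extChartAt_target x)))
  have hL : laplacian I₁ g₁ (fun x ↦ lam x ^ 2) x = _ :=
    (laplacian_eq_trace I₁ g₁ (fun x ↦ lam x ^ 2) x).trans hsq
  refine (ricci_warpedProduct_eq_ricciCoord I₁ I₂ x y _ _).trans (h.trans ?_)
  rw [hL, gradNormSq_eq_fderiv_gradCoord I₁ hg₁ (hlam.mdifferentiableAt (by simp)),
    inChart_self I₂ g₂ y]
  change ricci I₂ g₂ y v w - _ * g₂ y v w = _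
  ring

end WarpedRicci

/-! ### Second derivatives on an interval, and the evolution equations -/

namespace HasSecondDerivOn

variable {f f'' k k'' : ℝ → ℝ} {s : Set ℝ}

theorem congr (h : HasSecondDerivOn f f'' s) (hf : ∀ t ∈ s, k t = f t)
    (hf'' : ∀ t ∈ s, k'' t = f'' t) : HasSecondDerivOn k k'' s := by
  obtain ⟨f', h1, h2⟩ := h
  refine ⟨f', fun t ht ↦ (h1 t ht).congr hf (hf t ht), fun t ht ↦ ?_⟩
  rw [hf'' t ht]
  exact h2 t ht

theorem const_mul (h : HasSecondDerivOn f f'' s) (a : ℝ) :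
    HasSecondDerivOn (fun t ↦ a * f t) (fun t ↦ a * f'' t) s := by
  obtain ⟨f', h1, h2⟩ := h
  exact ⟨fun t ↦ a * f' t, fun t ht ↦ (h1 t ht).const_mul a, fun t ht ↦ (h2 t ht).const_mul a⟩

end HasSecondDerivOn

end WarpedFlow

theorem proposition5p3
    {E₁ : Type*} [NormedAddCommGroup E₁] [NormedSpace ℝ E₁] [FiniteDimensional ℝ E₁]
    {H₁ : Type*} [TopologicalSpace H₁] (I₁ : ModelWithCorners ℝ E₁ H₁) [I₁.Boundaryless]
    {M₁ : Type*} [TopologicalSpace M₁] [ChartedSpace H₁ M₁] [IsManifold I₁ ∞ M₁]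
    {E₂ : Type*} [NormedAddCommGroup E₂] [NormedSpace ℝ E₂] [FiniteDimensional ℝ E₂]
    {H₂ : Type*} [TopologicalSpace H₂] (I₂ : ModelWithCorners ℝ E₂ H₂) [I₂.Boundaryless]
    {M₂ : Type*} [TopologicalSpace M₂] [ChartedSpace H₂ M₂] [IsManifold I₂ ∞ M₂] [Nonempty M₂]
    (m₂ : ℕ) (hm₂ : Module.finrank ℝ E₂ = m₂) (hm₂_pos : 1 ≤ m₂)
    (T : EReal)
    (g₁ : ℝ → WarpedFlow.FormField I₁ M₁)
    (hg₁ : ∀ t ∈ WarpedFlow.timeInterval T, WarpedFlow.IsRiemannianMetric I₁ (g₁ t))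
    (lam : ℝ → M₁ → ℝ)
    (hlam_smooth : ∀ t ∈ WarpedFlow.timeInterval T, ContMDiff I₁ 𝓘(ℝ, ℝ) ∞ (lam t))
    (hlam_pos : ∀ t ∈ WarpedFlow.timeInterval T, ∀ x : M₁, 0 < lam t x)
    (g₂ : WarpedFlow.FormField I₂ M₂) (c : ℝ) (hg₂ : WarpedFlow.IsEinstein I₂ g₂ c)
    (hflow : WarpedFlow.IsHyperbolicGeometricFlow (I₁.prod I₂) T
      (fun t ↦ WarpedFlow.warpedProduct I₁ I₂ (g₁ t) (lam t) g₂)) :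
    (∀ (x : M₁) (v w : TangentSpace I₁ x),
      WarpedFlow.HasSecondDerivOn (fun t ↦ g₁ t x v w)
        (fun t ↦ -2 * WarpedFlow.ricci I₁ (g₁ t) x v w +
          2 * (m₂ : ℝ) / lam t x * WarpedFlow.hessian I₁ (g₁ t) (lam t) x v w)
        (WarpedFlow.timeInterval T)) ∧
    (∀ x : M₁,
      WarpedFlow.HasSecondDerivOn (fun t ↦ (lam t x) ^ 2)
        (fun t ↦ -2 * c + WarpedFlow.laplacian I₁ (g₁ t) (fun y ↦ (lam t y) ^ 2) x +
          (2 * (m₂ : ℝ) - 4) * WarpedFlow.gradNormSq I₁ (g₁ t) (lam t) x)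
        (WarpedFlow.timeInterval T)) := by
  have y : M₂ := Classical.arbitrary M₂
  refine ⟨fun x v w ↦ ?_, fun x ↦ ?_⟩
  · refine (hflow.evolution (x, y) ((v, 0) : E₁ × E₂) ((w, 0) : E₁ × E₂)).congr
      (fun t _ ↦ (WarpedFlow.warpedProduct_horizontal I₁ I₂ _ _ g₂ x y v w).symm) (fun t ht ↦ ?_)
    rw [WarpedFlow.ricci_warpedProduct_horizontal I₁ I₂ (hg₁ t ht) (hlam_smooth t ht)
      (fun x ↦ (hlam_pos t ht x).ne') hg₂.1 x y v w, hm₂]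
    ring
  · have : Nontrivial E₂ := Module.nontrivial_of_finrank_pos (R := ℝ) (by omega)
    obtain ⟨b, hb⟩ : ∃ b : TangentSpace I₂ y, b ≠ 0 := exists_ne (0 : E₂)
    have hpos : 0 < g₂ y b b := hg₂.1.pos y b hb
    -- on the vector `b` tangent to the fibre, the flow is `λ²` times the positive constant
    -- `g₂(b, b)`
    refine ((hflow.evolution (x, y) ((0, b) : E₁ × E₂) ((0, b) : E₁ × E₂)).const_mul
      (g₂ y b b)⁻¹).congr (fun t _ ↦ ?_) (fun t ht ↦ ?_)
    · rw [WarpedFlow.warpedProduct_vertical I₁ I₂ _ _ g₂ x y b b]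
      field_simp
    · rw [WarpedFlow.ricci_warpedProduct_vertical I₁ I₂ (hg₁ t ht) (hlam_smooth t ht)
        (fun x ↦ (hlam_pos t ht x).ne') hg₂.1 x y b b, hg₂.2 y b b, hm₂]
      field_simp
      ring
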